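/- Let $d\in\mathbb{N}=\{1,2,\dots\}$, $p,\alpha,\kappa,c\in(0,\infty)$, $\nu\in(0,1)$, $\xi,\vartheta\in\mathbb{R}^d$, let $q=\min\big(\{2,4,6,\dots\}\cap[p,\infty)\big)$, and let $\langle\cdot,\cdot\rangle$ and $\|\cdot\|$ be the Euclidean scalar product and norm on $\mathbb{R}^d$. Let $(\Omega,\mathcal{F},\mathbb{P})$ be a probability space, let $(S,\mathcal{S})$ be a measurable space, let $X_n\colon\Omega\to S$, $n\in\mathbb{N}$, be i.i.d. random variables, and let $F\colon\mathbb{R}^d\times S\to\mathbb{R}$ be measurable (with respect to the product $\sigma$-algebra $\mathcal{B}(\mathbb{R}^d)\otimes\mathcal{S}$) such that $\theta\mapsto F(\theta,x)$ is continuously differentiable for every $x\in S$. Assume that for all $\theta\in\mathbb{R}^d$ $$\mathbb{E}\big[|F(\theta,X_1)|+\|(\nabla_\theta F)(\theta,X_1)\|\big]<\infty,$$ $$\big\langle\theta-\vartheta,\mathbb{E}[(\nabla_\theta F)(\theta,X_1)]\big\rangle\ge c\,\max\big\{\|\theta-\vartheta\|^2,\ \|\mathbb{E}[(\nabla_\theta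 F)(\theta,X_1)]\|^2\big\},$$ $$\mathbb{E}\big[\|(\nabla_\theta F)(\theta,X_1)-\mathbb{E}[(\nabla_\theta F)(\theta,X_1)]\|^q\big]\le\kappa\,(1+\|\theta\|^q).$$ Let $\Theta\colon\mathbb{N}_0\times\Omega\to\mathbb{R}^d$ be the stochastic process given by $\Theta_0=\xi$ and, for all $n\in\mathbb{N}$, $$\Theta_n=\Theta_{n-1}-\frac{\alpha}{n^\nu}\,(\nabla_\theta F)(\Theta_{n-1},X_n).$$ Then (i) the function $\theta\mapsto\mathbb{E}[F(\theta,X_1)]$ is bounded from below and $$\Big\{\theta\in\mathbb{R}^d:\ \mathbb{E}[F(\theta,X_1)]=\inf_{v\in\mathbb{R}^d}\mathbb{E}[F(v,X_1)]\Big\}=\{\vartheta\},$$ that is, $\vartheta$ is its unique global minimizer; and (ii) there exists $C\in(0,\infty)$ such that for all $n\in\mathbb{N}$ $$\big(\mathbb{E}\big[\|\Theta_n-\vartheta\|^p\big]\big)^{1/p}\le C\,n^{-\nu/2}.$$ -/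

import Mathlib

open MeasureTheory ProbabilityTheory

/-! Write q = 2(m+1), γ for the step size, u = θ - ϑ, and split a sampled gradient into its mean G
and a centred noise z. Coercivity makes the mean step contract: ‖u - γG‖² ≤ (1 - cγ)‖u‖² once γ ≤ c.
Expanding the q-th power of the norm around w = u - γG, the term linear in z has mean zero. Young's
inequality absorbs the remainder into a small multiple of γ‖w‖^q plus a multiple of γ^(m+2)‖z‖^q.
Since the noise moment grows at most like 1 + ‖u‖^q, small steps give, for the error moments a_n =
E‖Θ_n - ϑ‖^q, a_{n+1} ≤ (1 - cγ/4) a_n + K γ^(m+2) (`exists_step_contraction`).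

The noise is one power of γ smaller than the target γ^(m+1), exactly what a contraction of strength
γ can balance. As ν < 1, γ varies slowly relative to that contraction, so a_n = O(γ^(m+1))
(`exists_le_mul_stepsize_pow`). Taking q-th roots gives order γ^(1/2), that is n^(-ν/2), and
monotonicity of L^p norms on a probability space passes from q to p.

For the minimizer, the sample functions are integrated along the segment from ϑ to θ and Fubini is
applied. Coercivity of the mean gradient then gives quadratic growth of the objective around ϑ
(`half_mul_norm_sub_sq_le_integral_sub`), without differentiating under the expectation. -/

/-! ### Elementary inequalities for powers. -/

lemma pow_mul_le_add_of_pos (m : ℕ) {x y ε : ℝ} (hx : 0 ≤ x) (hy : 0 ≤ y) (hε : 0 < ε) :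
    x ^ m * y ≤ ε * x ^ (m + 1) + (1 / ε) ^ m * y ^ (m + 1) := by
  rcases le_total y (ε * x) with h | h
  · have h1 : x ^ m * y ≤ x ^ m * (ε * x) := by gcongr
    have h2 : 0 ≤ (1 / ε) ^ m * y ^ (m + 1) := by positivity
    rw [pow_succ]
    nlinarith
  · have h0 : x ≤ 1 / ε * y := by
      rw [one_div, ← div_eq_inv_mul, le_div_iff₀ hε]
      linarith
    have h1 : x ^ m * y ≤ (1 / ε * y) ^ m * y := by gcongr
    have h2 : 0 ≤ ε * x ^ (m + 1) := by positivity
    rw [mul_pow] at h1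
    rw [pow_succ y]
    linarith

lemma pow_mul_pow_le_add {a b : ℝ} (ha : 0 ≤ a) (hb : 0 ≤ b) (i j : ℕ) :
    a ^ i * b ^ (j + 2) ≤ a ^ (i + j) * b ^ 2 + b ^ (i + j + 2) := by
  rcases le_total a b with h | h
  · have h1 : a ^ i * b ^ (j + 2) ≤ b ^ i * b ^ (j + 2) := by gcongr
    have h2 : 0 ≤ a ^ (i + j) * b ^ 2 := by positivity
    rw [← pow_add, ← add_assoc] at h1
    linarith
  · have h1 : a ^ i * (b ^ j * b ^ 2) ≤ a ^ i * (a ^ j * b ^ 2) := by gcongr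
    have h2 : 0 ≤ b ^ (i + j + 2) := by positivity
    rw [pow_add b j, pow_add a]
    linarith

/-! ### Expansion of even powers of the norm and the one-step estimate. -/

section InnerProductSpace

variable {E : Type*} [NormedAddCommGroup E] [InnerProductSpace ℝ E]

/-- A first-order Taylor bound, by induction on m: multiply the previous bound by ‖w + z‖² = ‖w‖² +
2⟨w, z⟩ + ‖z‖². The linear term must keep its exact coefficient, because it is later integrated to
zero; every other mixed term lies between the two extreme terms of the remainder. -/
lemma exists_norm_add_pow_le (m : ℕ) : ∃ C : ℝ, 0 ≤ C ∧ ∀ w z : E,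
    ‖w + z‖ ^ (2 * (m + 1)) ≤ ‖w‖ ^ (2 * (m + 1))
      + 2 * (m + 1) * ‖w‖ ^ (2 * m) * inner ℝ w z
      + C * (‖w‖ ^ (2 * m) * ‖z‖ ^ 2 + ‖z‖ ^ (2 * (m + 1))) := by
  induction m with
  | zero =>
    refine ⟨1, zero_le_one, fun w z => ?_⟩
    have := norm_add_sq_real w z
    simp only [Nat.mul_zero, pow_zero, zero_add, Nat.mul_one, Nat.cast_zero]
    nlinarith [sq_nonneg ‖z‖]
  | succ m ih =>
    obtain ⟨C, hC, ih⟩ := ih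
    -- Each summand is the coefficient of one error term in the product, and each such term is at
    -- most `D`; the previous remainder contributes 6C.
    refine ⟨1 + (4 * m + 4) + (2 * m + 2) + 6 * C, by positivity, fun w z => ?_⟩
    specialize ih w z
    have hN := norm_add_sq_real w z
    have hs := abs_real_inner_le_norm w z
    set s : ℝ := inner ℝ w z
    have ha := norm_nonneg w
    have hb := norm_nonneg z
    set a := ‖w‖
    set b := ‖z‖
    obtain ⟨hs1, hs2⟩ := abs_le.1 hs
    have hss : s ^ 2 ≤ a ^ 2 * b ^ 2 := by
      rw [← mul_pow]; exact sq_le_sq' hs1 hs2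
    set D := a ^ (2 * m + 2) * b ^ 2 + b ^ (2 * m + 4) with hD
    have hD0 : 0 ≤ D := by positivity
    have e1 : a ^ (2 * m + 2) * b ^ 2 ≤ D := by
      have : 0 ≤ b ^ (2 * m + 4) := by positivity
      linarith
    have e2 : a ^ (2 * m) * s ^ 2 ≤ D := by
      have : a ^ (2 * m) * s ^ 2 ≤ a ^ (2 * m) * (a ^ 2 * b ^ 2) := by gcongr
      rw [← mul_assoc, ← pow_add] at this
      linarith
    have e3 : a ^ (2 * m) * s * b ^ 2 ≤ D := by
      have h1 : a ^ (2 * m) * s * b ^ 2 ≤ a ^ (2 * m) * (a * b) * b ^ 2 := by gcongr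
      have h2 := pow_mul_pow_le_add ha hb (2 * m + 1) 1
      have h3 : a ^ (2 * m) * (a * b) * b ^ 2 = a ^ (2 * m + 1) * b ^ (1 + 2) := by ring
      calc _ ≤ _ := h1
        _ = _ := h3
        _ ≤ _ := h2
    have e4 : a ^ 2 * b ^ (2 * m + 2) ≤ D := by
      have h2 := pow_mul_pow_le_add ha hb 2 (2 * m)
      rw [add_comm 2 (2 * m)] at h2
      exact h2
    have e5 : a ^ (2 * m) * b ^ 4 ≤ D := pow_mul_pow_le_add ha hb (2 * m) 2
    have hN2 : ‖w + z‖ ^ 2 ≤ 2 * (a ^ 2 + b ^ 2) := by nlinarith [sq_nonneg (a - b)]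
    have e6 : ‖w + z‖ ^ 2 * (C * (a ^ (2 * m) * b ^ 2 + b ^ (2 * m + 2))) ≤ 6 * C * D := by
      have h1 : ‖w + z‖ ^ 2 * (C * (a ^ (2 * m) * b ^ 2 + b ^ (2 * m + 2)))
          ≤ 2 * (a ^ 2 + b ^ 2) * (C * (a ^ (2 * m) * b ^ 2 + b ^ (2 * m + 2))) := by gcongr
      have h2 : 2 * (a ^ 2 + b ^ 2) * (C * (a ^ (2 * m) * b ^ 2 + b ^ (2 * m + 2)))
          = 2 * C * (D + a ^ 2 * b ^ (2 * m + 2) + a ^ (2 * m) * b ^ 4) := by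
        rw [hD]; ring
      have h3 : 2 * C * (D + a ^ 2 * b ^ (2 * m + 2) + a ^ (2 * m) * b ^ 4)
          ≤ 2 * C * (D + D + D) := by gcongr
      linarith
    have e7 : ‖w + z‖ ^ (2 * (m + 1 + 1)) = ‖w + z‖ ^ 2 * ‖w + z‖ ^ (2 * (m + 1)) := by ring
    have e8 := mul_le_mul_of_nonneg_left ih (sq_nonneg ‖w + z‖)
    have e9 : ‖w + z‖ ^ 2 * (a ^ (2 * (m + 1)) + 2 * (m + 1) * a ^ (2 * m) * s
        + C * (a ^ (2 * m) * b ^ 2 + b ^ (2 * (m + 1))))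
        = a ^ (2 * m + 4) + 2 * (m + 2) * a ^ (2 * m + 2) * s
          + a ^ (2 * m + 2) * b ^ 2 + (4 * m + 4) * (a ^ (2 * m) * s ^ 2)
          + (2 * m + 2) * (a ^ (2 * m) * s * b ^ 2)
          + ‖w + z‖ ^ 2 * (C * (a ^ (2 * m) * b ^ 2 + b ^ (2 * m + 2))) := by
      rw [mul_add, hN]; ring
    have hm : (0 : ℝ) ≤ m := Nat.cast_nonneg m
    have f2 : (4 * m + 4 : ℝ) * (a ^ (2 * m) * s ^ 2) ≤ (4 * m + 4) * D := by gcongr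
    have f3 : (2 * m + 2 : ℝ) * (a ^ (2 * m) * s * b ^ 2) ≤ (2 * m + 2) * D := by gcongr
    have g1 : a ^ (2 * (m + 1 + 1)) + 2 * (((m + 1 : ℕ) : ℝ) + 1) * a ^ (2 * (m + 1)) * s
        + (1 + (4 * m + 4) + (2 * m + 2) + 6 * C)
          * (a ^ (2 * (m + 1)) * b ^ 2 + b ^ (2 * (m + 1 + 1)))
        = a ^ (2 * m + 4) + 2 * (m + 2) * a ^ (2 * m + 2) * s
          + (1 + (4 * m + 4) + (2 * m + 2) + 6 * C) * D := by
      rw [hD]; push_cast; ring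
    rw [g1, e7]
    nlinarith

/-- Young's inequality with x = ‖w‖² and y = η‖z‖² splits the mixed remainder. The extra factor η
left over is what yields both εη in front of ‖w‖ and the power η^(m+2) in front of ‖z‖. -/
lemma exists_norm_sub_smul_pow_le (m : ℕ) {ε : ℝ} (hε : 0 < ε) :
    ∃ C : ℝ, 0 ≤ C ∧ ∀ (w z : E) (η : ℝ), 0 ≤ η → η ≤ 1 →
      ‖w - η • z‖ ^ (2 * (m + 1)) ≤ (1 + ε * η) * ‖w‖ ^ (2 * (m + 1))
        - 2 * (m + 1) * η * ‖w‖ ^ (2 * m) * inner ℝ w z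
        + C * η ^ (m + 2) * ‖z‖ ^ (2 * (m + 1)) := by
  obtain ⟨C, hC, h⟩ := exists_norm_add_pow_le (E := E) m
  -- Chosen so that C δ ≤ ε; the added 1 covers C = 0.
  set δ := ε / (C + 1) with hδ
  have hδ0 : 0 < δ := by positivity
  refine ⟨C * ((1 / δ) ^ m + 1), by positivity, fun w z η hη hη1 => ?_⟩
  have h1 := h w (-(η • z))
  rw [← sub_eq_add_neg, norm_neg, norm_smul, Real.norm_of_nonneg hη, inner_neg_right,
    real_inner_smul_right] at h1
  have hy := pow_mul_le_add_of_pos m (sq_nonneg ‖w‖) (y := η * ‖z‖ ^ 2) (by positivity) hδ0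
  have h2 : ‖w‖ ^ (2 * m) * (η * ‖z‖) ^ 2
      ≤ η * (δ * ‖w‖ ^ (2 * (m + 1)) + (1 / δ) ^ m * (η ^ (m + 1) * ‖z‖ ^ (2 * (m + 1)))) := by
    have := mul_le_mul_of_nonneg_left hy hη
    rw [mul_pow η, ← pow_mul, ← pow_mul, ← pow_mul] at this
    calc _ = η * (‖w‖ ^ (2 * m) * (η * ‖z‖ ^ 2)) := by ring
      _ ≤ _ := this
  have h3 : (η * ‖z‖) ^ (2 * (m + 1)) ≤ η ^ (m + 2) * ‖z‖ ^ (2 * (m + 1)) := by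
    rw [mul_pow]
    gcongr ?_ * _
    exact pow_le_pow_of_le_one hη hη1 (by omega)
  have h4 : C * δ ≤ ε := by
    rw [hδ, mul_div_assoc', div_le_iff₀ (by positivity)]
    nlinarith
  have h5 : C * δ * (η * ‖w‖ ^ (2 * (m + 1))) ≤ ε * (η * ‖w‖ ^ (2 * (m + 1))) := by gcongr
  have h6 := mul_le_mul_of_nonneg_left (add_le_add h2 h3) hC
  calc _ ≤ _ := h1
    _ ≤ ‖w‖ ^ (2 * (m + 1)) + 2 * (m + 1) * ‖w‖ ^ (2 * m) * -(η * inner ℝ w z)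
        + C * (η * (δ * ‖w‖ ^ (2 * (m + 1)) + (1 / δ) ^ m * (η ^ (m + 1) * ‖z‖ ^ (2 * (m + 1))))
          + η ^ (m + 2) * ‖z‖ ^ (2 * (m + 1))) := by gcongr
    _ = ‖w‖ ^ (2 * (m + 1)) + C * δ * (η * ‖w‖ ^ (2 * (m + 1)))
        - 2 * (m + 1) * η * ‖w‖ ^ (2 * m) * inner ℝ w z
        + C * ((1 / δ) ^ m + 1) * η ^ (m + 2) * ‖z‖ ^ (2 * (m + 1)) := by ring
    _ ≤ _ := by linarith

lemma norm_le_div_of_coercive {u G : E} {c : ℝ} (hc : 0 < c)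
    (h : c * max (‖u‖ ^ 2) (‖G‖ ^ 2) ≤ inner ℝ u G) : ‖G‖ ≤ ‖u‖ / c := by
  rw [le_div_iff₀ hc]
  have h1 : c * ‖G‖ ^ 2 ≤ ‖u‖ * ‖G‖ :=
    (mul_le_mul_of_nonneg_left (le_max_right _ _) hc.le).trans (h.trans (real_inner_le_norm u G))
  rcases (norm_nonneg G).eq_or_lt with h0 | h0
  · rw [← h0]; simp
  · nlinarith

lemma norm_sub_smul_sq_le_of_coercive {u G : E} {c η : ℝ} (hη : 0 ≤ η) (hηc : η ≤ c)
    (h : c * max (‖u‖ ^ 2) (‖G‖ ^ 2) ≤ inner ℝ u G) :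
    ‖u - η • G‖ ^ 2 ≤ (1 - c * η) * ‖u‖ ^ 2 := by
  have hc : 0 ≤ c := hη.trans hηc
  rw [norm_sub_sq_real, real_inner_smul_right, norm_smul, Real.norm_of_nonneg hη]
  have h1 := (mul_le_mul_of_nonneg_left (le_max_left (‖u‖ ^ 2) (‖G‖ ^ 2)) hc).trans h
  have h2 := (mul_le_mul_of_nonneg_left (le_max_right (‖u‖ ^ 2) (‖G‖ ^ 2)) hc).trans h
  have h3 : η * (c * ‖u‖ ^ 2) ≤ η * inner ℝ u G := by gcongr
  have h4 : η * (c * ‖G‖ ^ 2) ≤ η * inner ℝ u G := by gcongr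
  have h5 : η * (η * ‖G‖ ^ 2) ≤ η * (c * ‖G‖ ^ 2) := by gcongr
  nlinarith

variable [CompleteSpace E] {S : Type*} [MeasurableSpace S]

/-- The mean step contracts by 1 - cη and Young's inequality costs a factor 1 + cη/2, leaving 1 -
cη/2. The constant depends on neither the measure nor the step size. -/
lemma exists_lintegral_norm_sub_smul_pow_le (m : ℕ) {c : ℝ} (hc : 0 < c) :
    ∃ C : ℝ, 0 ≤ C ∧ ∀ (μ : Measure S) [IsProbabilityMeasure μ] (h : S → E) (u : E) (η M : ℝ),
      Integrable h μ → 0 ≤ η → η ≤ 1 → η ≤ c → c * η ≤ 1 → 0 ≤ M →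
      c * max (‖u‖ ^ 2) (‖∫ x, h x ∂μ‖ ^ 2) ≤ inner ℝ u (∫ x, h x ∂μ) →
      ∫⁻ x, ‖h x - ∫ y, h y ∂μ‖ₑ ^ (2 * (m + 1)) ∂μ ≤ ENNReal.ofReal M →
      ∫⁻ x, ‖u - η • h x‖ₑ ^ (2 * (m + 1)) ∂μ
        ≤ ENNReal.ofReal ((1 - c / 2 * η) * ‖u‖ ^ (2 * (m + 1)) + C * η ^ (m + 2) * M) := by
  obtain ⟨C, hC, hCle⟩ := exists_norm_sub_smul_pow_le (E := E) m (half_pos hc)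
  refine ⟨C, hC, fun μ _ h u η M hh hη hη1 hηc hcη hM hcoer hmom => ?_⟩
  set G := ∫ x, h x ∂μ with hG
  set w := u - η • G with hw
  have hN : Integrable (fun x => h x - G) μ := hh.sub (integrable_const G)
  -- The vector `w` is deterministic and the noise is centred, so the first-order term disappears.
  have hN0 : ∫ x, inner ℝ w (h x - G) ∂μ = 0 := by
    rw [integral_inner hN, integral_sub hh (integrable_const G)]
    simp [hG]
  have hpow : ∀ v : E, ‖v‖ₑ ^ (2 * (m + 1)) = ENNReal.ofReal (‖v‖ ^ (2 * (m + 1))) := fun v => by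
    rw [ENNReal.ofReal_pow (norm_nonneg v), ofReal_norm]
  simp_rw [hpow] at hmom ⊢
  have hNq : Integrable (fun x => ‖h x - G‖ ^ (2 * (m + 1))) μ :=
    (lintegral_ofReal_ne_top_iff_integrable (hN.1.norm.pow _)
      (Filter.Eventually.of_forall fun x => pow_nonneg (norm_nonneg _) _)).1
      (hmom.trans_lt ENNReal.ofReal_lt_top).ne
  have hNM : ∫ x, ‖h x - G‖ ^ (2 * (m + 1)) ∂μ ≤ M := by
    rw [← ofReal_integral_eq_lintegral_ofReal hNq
      (Filter.Eventually.of_forall fun x => by positivity)] at hmom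
    exact (ENNReal.ofReal_le_ofReal_iff hM).1 hmom
  have hle : ∀ x, ‖u - η • h x‖ ^ (2 * (m + 1)) ≤ (1 + c / 2 * η) * ‖w‖ ^ (2 * (m + 1))
        - 2 * (m + 1) * η * ‖w‖ ^ (2 * m) * inner ℝ w (h x - G)
        + C * η ^ (m + 2) * ‖h x - G‖ ^ (2 * (m + 1)) := fun x => by
    have := hCle w (h x - G) η hη hη1
    rwa [show w - η • (h x - G) = u - η • h x by rw [hw, smul_sub]; abel] at this
  have hi1 : Integrable (fun x => (1 + c / 2 * η) * ‖w‖ ^ (2 * (m + 1))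
        - 2 * (m + 1) * η * ‖w‖ ^ (2 * m) * inner ℝ w (h x - G)) μ :=
    (integrable_const _).sub ((hN.const_inner w).const_mul _)
  have hi2 : Integrable (fun x => C * η ^ (m + 2) * ‖h x - G‖ ^ (2 * (m + 1))) μ :=
    hNq.const_mul _
  have hw2 : ‖w‖ ^ (2 * (m + 1)) ≤ (1 - c * η) * ‖u‖ ^ (2 * (m + 1)) := by
    have h1 := norm_sub_smul_sq_le_of_coercive hη hηc hcoer
    calc ‖w‖ ^ (2 * (m + 1)) = (‖w‖ ^ 2) ^ (m + 1) := by rw [pow_mul]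
      _ ≤ ((1 - c * η) * ‖u‖ ^ 2) ^ (m + 1) := by gcongr
      _ = (1 - c * η) ^ (m + 1) * ‖u‖ ^ (2 * (m + 1)) := by rw [mul_pow, ← pow_mul]
      _ ≤ _ := by
        gcongr
        exact pow_le_of_le_one (by linarith) (by nlinarith) (by omega)
  calc ∫⁻ x, ENNReal.ofReal (‖u - η • h x‖ ^ (2 * (m + 1))) ∂μ
      ≤ ∫⁻ x, ENNReal.ofReal ((1 + c / 2 * η) * ‖w‖ ^ (2 * (m + 1))
        - 2 * (m + 1) * η * ‖w‖ ^ (2 * m) * inner ℝ w (h x - G)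
        + C * η ^ (m + 2) * ‖h x - G‖ ^ (2 * (m + 1))) ∂μ :=
        lintegral_mono fun x => ENNReal.ofReal_le_ofReal (hle x)
    _ = ENNReal.ofReal (∫ x, ((1 + c / 2 * η) * ‖w‖ ^ (2 * (m + 1))
        - 2 * (m + 1) * η * ‖w‖ ^ (2 * m) * inner ℝ w (h x - G)
        + C * η ^ (m + 2) * ‖h x - G‖ ^ (2 * (m + 1))) ∂μ) := by
        exact (ofReal_integral_eq_lintegral_ofReal (hi1.add hi2) (Filter.Eventually.of_forall
          fun x => (pow_nonneg (norm_nonneg _) _).trans (hle x))).symm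
    _ = ENNReal.ofReal ((1 + c / 2 * η) * ‖w‖ ^ (2 * (m + 1))
        + C * η ^ (m + 2) * ∫ x, ‖h x - G‖ ^ (2 * (m + 1)) ∂μ) := by
        rw [integral_add hi1 hi2, integral_sub (integrable_const _)
          ((hN.const_inner w).const_mul _), integral_const_mul, integral_const_mul,
          integral_const_mul, hN0]
        simp
    _ ≤ _ := by
        apply ENNReal.ofReal_le_ofReal
        have h1 : (1 + c / 2 * η) * ‖w‖ ^ (2 * (m + 1))
            ≤ (1 - c / 2 * η) * ‖u‖ ^ (2 * (m + 1)) :=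
          calc (1 + c / 2 * η) * ‖w‖ ^ (2 * (m + 1))
              ≤ (1 + c / 2 * η) * ((1 - c * η) * ‖u‖ ^ (2 * (m + 1))) := by gcongr
            _ = ((1 + c / 2 * η) * (1 - c * η)) * ‖u‖ ^ (2 * (m + 1)) := by ring
            _ ≤ _ := by
              gcongr ?_ * _
              nlinarith [mul_nonneg (mul_nonneg hc.le hη) (mul_nonneg hc.le hη)]
        gcongr

end InnerProductSpace

/-! ### Measurability and continuity of the gradient. -/

section Gradient

variable {E : Type*} [NormedAddCommGroup E] [InnerProductSpace ℝ E] [FiniteDimensional ℝ E]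
  {S : Type*}

lemma gradient_eq_sum_fderiv {ι : Type*} [Fintype ι] (b : OrthonormalBasis ι ℝ E)
    (f : E → ℝ) (θ : E) : gradient f θ = ∑ i, fderiv ℝ f θ (b i) • b i := by
  conv_lhs => rw [← b.sum_repr' (gradient f θ)]
  refine Finset.sum_congr rfl fun i _ => ?_
  rw [real_inner_comm, gradient, InnerProductSpace.toDual_symm_apply]

lemma measurable_gradient_of_measurable_uncurry [MeasurableSpace E] [BorelSpace E]
    [SecondCountableTopology E] [MeasurableSpace S] {F : E → S → ℝ}
    (hF : Measurable (Function.uncurry F)) (hd : ∀ x, Differentiable ℝ fun θ => F θ x) :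
    Measurable fun z : E × S => gradient (fun η => F η z.2) z.1 := by
  simp_rw [gradient_eq_sum_fderiv (stdOrthonormalBasis ℝ E)]
  refine Finset.measurable_sum _ fun i _ => Measurable.smul_const ?_ _
  set v := stdOrthonormalBasis ℝ E i
  -- Each directional derivative is a pointwise limit of jointly measurable difference quotients
  -- with increment 1/n; the degenerate term n = 0 is identically zero.
  refine measurable_of_tendsto_metrizable (f := fun (n : ℕ) (z : E × S) =>
    (n : ℝ) • (F (z.1 + (n : ℝ)⁻¹ • v) z.2 - F z.1 z.2)) (fun n => ?_) ?_
  · have h1 : Measurable fun z : E × S => F (z.1 + (n : ℝ)⁻¹ • v) z.2 :=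
      hF.comp ((measurable_fst.add_const _).prodMk measurable_snd)
    exact (h1.sub hF).const_mul (n : ℝ)
  · refine tendsto_pi_nhds.2 fun z => ?_
    refine ((hd z.2) z.1).hasFDerivAt.lim v ?_
    simpa using tendsto_natCast_atTop_atTop

lemma hasDerivAt_comp_add_smul {f : E → ℝ} (hf : Differentiable ℝ f) (a v : E) (t : ℝ) :
    HasDerivAt (fun t : ℝ => f (a + t • v)) (inner ℝ v (gradient f (a + t • v))) t := by
  have h1 : HasDerivAt (fun t : ℝ => a + t • v) v t := by
    simpa using ((hasDerivAt_id t).smul_const v).const_add a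
  have h2 := (hf (a + t • v)).hasFDerivAt.comp_hasDerivAt t h1
  rwa [real_inner_comm, gradient, InnerProductSpace.toDual_symm_apply]

lemma continuous_gradient {f : E → ℝ} (hf : ContDiff ℝ 1 f) : Continuous (gradient f) :=
  (InnerProductSpace.toDual ℝ E).symm.continuous.comp (hf.continuous_fderiv one_ne_zero)

end Gradient

/-! ### Consequences of the noise moment bound for one step. -/

section Moments

variable {E : Type*} [NormedAddCommGroup E]

lemma exists_mul_one_add_norm_pow_le {κ : ℝ} (hκ : 0 ≤ κ) (q : ℕ) (ϑ : E) :
    ∃ L : ℝ, 0 ≤ L ∧ ∀ θ : E, κ * (1 + ‖θ‖ ^ q) ≤ L * (1 + ‖θ - ϑ‖ ^ q) := by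
  refine ⟨κ * (1 + 2 ^ (q - 1) * (1 + ‖ϑ‖ ^ q)), by positivity, fun θ => ?_⟩
  rw [mul_assoc]
  gcongr
  have h1 : ‖θ‖ ≤ ‖θ - ϑ‖ + ‖ϑ‖ := by simpa using norm_add_le (θ - ϑ) ϑ
  have h2 : ‖θ‖ ^ q ≤ 2 ^ (q - 1) * (‖θ - ϑ‖ ^ q + ‖ϑ‖ ^ q) :=
    (pow_le_pow_left₀ (norm_nonneg _) h1 q).trans
      (add_pow_le (norm_nonneg _) (norm_nonneg _) q)
  have h3 : 0 ≤ ‖θ - ϑ‖ ^ q := by positivity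
  have h4 : 0 ≤ ‖ϑ‖ ^ q := by positivity
  have h5 : (0 : ℝ) ≤ 2 ^ (q - 1) := by positivity
  nlinarith [mul_nonneg h5 (mul_nonneg h3 h4)]

lemma enorm_pow_eq_ofReal (v : E) (q : ℕ) : ‖v‖ₑ ^ q = ENNReal.ofReal (‖v‖ ^ q) := by
  rw [ENNReal.ofReal_pow (norm_nonneg v), ofReal_norm]

variable [InnerProductSpace ℝ E] {S : Type*} [MeasurableSpace S]
  {μ : Measure S} [IsProbabilityMeasure μ] {g : E → S → E} {c L : ℝ} {ϑ : E}

lemma exists_step_contraction [CompleteSpace E] (m : ℕ) (hc : 0 < c) (hL : 0 ≤ L)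
    (hgi : ∀ θ, Integrable (g θ) μ)
    (hcoer : ∀ θ, c * max (‖θ - ϑ‖ ^ 2) (‖∫ x, g θ x ∂μ‖ ^ 2)
      ≤ inner ℝ (θ - ϑ) (∫ x, g θ x ∂μ))
    (hmom : ∀ θ, ∫⁻ x, ‖g θ x - ∫ y, g θ y ∂μ‖ₑ ^ (2 * (m + 1)) ∂μ
      ≤ ENNReal.ofReal (L * (1 + ‖θ - ϑ‖ ^ (2 * (m + 1))))) :
    ∃ η₀ K : ℝ, 0 < η₀ ∧ c * η₀ ≤ 1 ∧ 0 ≤ K ∧ ∀ η, 0 ≤ η → η ≤ η₀ → ∀ θ,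
      ∫⁻ x, ‖θ - ϑ - η • g θ x‖ₑ ^ (2 * (m + 1)) ∂μ
        ≤ ENNReal.ofReal ((1 - c / 4 * η) * ‖θ - ϑ‖ ^ (2 * (m + 1)) + K * η ^ (m + 2)) := by
  obtain ⟨C, hC, h⟩ := exists_lintegral_norm_sub_smul_pow_le (E := E) (S := S) m hc
  have hCL : 0 ≤ C * L := by positivity
  -- The first three bounds are required by the one-step estimate. The last ensures C L η^(m+2) ≤
  -- (c/4) η, so the part of the noise proportional to ‖θ - ϑ‖^q costs only half of the contraction
  -- c/2.
  refine ⟨min 1 (min c (min (1 / c) (c / (4 * (C * L + 1))))), C * L, by positivity, ?_, hCL,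
    fun η hη hηle θ => ?_⟩
  · have : min 1 (min c (min (1 / c) (c / (4 * (C * L + 1))))) ≤ 1 / c :=
      (min_le_right _ _).trans ((min_le_right _ _).trans (min_le_left _ _))
    rwa [le_div_iff₀ hc, mul_comm] at this
  simp only [le_min_iff] at hηle
  obtain ⟨h1, h2, h3, h4⟩ := hηle
  rw [le_div_iff₀ hc, mul_comm] at h3
  rw [le_div_iff₀ (by positivity)] at h4
  refine (h μ (g θ) (θ - ϑ) η _ (hgi θ) hη h1 h2 h3 (by positivity) (hcoer θ) (hmom θ)).trans ?_
  apply ENNReal.ofReal_le_ofReal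
  have h5 : C * L * η ^ (m + 2) ≤ c / 4 * η := by
    have h6 : η ^ (m + 2) ≤ η ^ 2 := pow_le_pow_of_le_one hη h1 (by omega)
    calc C * L * η ^ (m + 2) ≤ C * L * η ^ 2 := by gcongr
      _ = (C * L * η) * η := by ring
      _ ≤ _ := by
        gcongr
        nlinarith
  have h7 : 0 ≤ ‖θ - ϑ‖ ^ (2 * (m + 1)) := by positivity
  nlinarith [mul_le_mul_of_nonneg_right h5 h7]

/-- Early steps may be too large to contract; this crude bound, valid for every step size, only
serves to keep all moments finite. -/
lemma exists_step_growth (q : ℕ) (hc : 0 < c) (hL : 0 ≤ L)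
    (hcoer : ∀ θ, c * max (‖θ - ϑ‖ ^ 2) (‖∫ x, g θ x ∂μ‖ ^ 2)
      ≤ inner ℝ (θ - ϑ) (∫ x, g θ x ∂μ))
    (hmom : ∀ θ, ∫⁻ x, ‖g θ x - ∫ y, g θ y ∂μ‖ₑ ^ q ∂μ
      ≤ ENNReal.ofReal (L * (1 + ‖θ - ϑ‖ ^ q))) {η : ℝ} (hη : 0 ≤ η) :
    ∃ A : ℝ, 0 ≤ A ∧ ∀ θ, ∫⁻ x, ‖θ - ϑ - η • g θ x‖ₑ ^ q ∂μ
        ≤ ENNReal.ofReal (A * ‖θ - ϑ‖ ^ q + A) := by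
  set A₁ := 2 ^ (q - 1) * (1 + η / c) ^ q with hA₁
  set A₂ := 2 ^ (q - 1) * η ^ q with hA₂
  have hA₁0 : 0 ≤ A₁ := by positivity
  have hA₂0 : 0 ≤ A₂ := by positivity
  refine ⟨A₁ + A₂ * L, by positivity, fun θ => ?_⟩
  set u := θ - ϑ
  set G := ∫ x, g θ x ∂μ
  have hG : ‖G‖ ≤ ‖u‖ / c := norm_le_div_of_coercive hc (hcoer θ)
  have hle : ∀ x, ‖u - η • g θ x‖ₑ ^ q
      ≤ ENNReal.ofReal (A₁ * ‖u‖ ^ q) + ENNReal.ofReal A₂ * ‖g θ x - G‖ₑ ^ q := fun x => by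
    rw [enorm_pow_eq_ofReal, enorm_pow_eq_ofReal, ← ENNReal.ofReal_mul hA₂0,
      ← ENNReal.ofReal_add (by positivity) (by positivity)]
    apply ENNReal.ofReal_le_ofReal
    have h1 : ‖u - η • g θ x‖ ≤ (1 + η / c) * ‖u‖ + η * ‖g θ x - G‖ := by
      have h2 : u - η • g θ x = (u - η • G) - η • (g θ x - G) := by rw [smul_sub]; abel
      rw [h2]
      refine (norm_sub_le _ _).trans (add_le_add ((norm_sub_le _ _).trans ?_) ?_)
      · rw [norm_smul, Real.norm_of_nonneg hη]
        have : η * ‖G‖ ≤ η * (‖u‖ / c) := by gcongr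
        calc _ ≤ ‖u‖ + η * (‖u‖ / c) := by gcongr
          _ = _ := by ring
      · rw [norm_smul, Real.norm_of_nonneg hη]
    calc ‖u - η • g θ x‖ ^ q ≤ ((1 + η / c) * ‖u‖ + η * ‖g θ x - G‖) ^ q := by gcongr
      _ ≤ 2 ^ (q - 1) * (((1 + η / c) * ‖u‖) ^ q + (η * ‖g θ x - G‖) ^ q) :=
        add_pow_le (by positivity) (by positivity) q
      _ = _ := by rw [hA₁, hA₂, mul_pow, mul_pow]; ring
  calc ∫⁻ x, ‖u - η • g θ x‖ₑ ^ q ∂μ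
      ≤ ∫⁻ x, (ENNReal.ofReal (A₁ * ‖u‖ ^ q) + ENNReal.ofReal A₂ * ‖g θ x - G‖ₑ ^ q) ∂μ :=
        lintegral_mono hle
    _ = ENNReal.ofReal (A₁ * ‖u‖ ^ q)
        + ENNReal.ofReal A₂ * ∫⁻ x, ‖g θ x - G‖ₑ ^ q ∂μ := by
        rw [lintegral_add_left measurable_const, lintegral_const_mul' _ _ ENNReal.ofReal_ne_top]
        simp
    _ ≤ ENNReal.ofReal (A₁ * ‖u‖ ^ q)
        + ENNReal.ofReal A₂ * ENNReal.ofReal (L * (1 + ‖u‖ ^ q)) := by gcongr; exact hmom θ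
    _ = ENNReal.ofReal (A₁ * ‖u‖ ^ q + A₂ * (L * (1 + ‖u‖ ^ q))) := by
        rw [← ENNReal.ofReal_mul hA₂0, ← ENNReal.ofReal_add (by positivity) (by positivity)]
    _ ≤ _ := by
        apply ENNReal.ofReal_le_ofReal
        have : 0 ≤ ‖u‖ ^ q := by positivity
        nlinarith

/-- Supplies a bound uniform on bounded sets of θ, which pointwise integrability does not give; it
justifies Fubini along a segment. -/
lemma integral_norm_le_of_moment {q : ℕ} (hq : q ≠ 0) (hc : 0 < c) (hL : 0 ≤ L)
    (hgi : ∀ θ, Integrable (g θ) μ)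
    (hcoer : ∀ θ, c * max (‖θ - ϑ‖ ^ 2) (‖∫ x, g θ x ∂μ‖ ^ 2)
      ≤ inner ℝ (θ - ϑ) (∫ x, g θ x ∂μ))
    (hmom : ∀ θ, ∫⁻ x, ‖g θ x - ∫ y, g θ y ∂μ‖ₑ ^ q ∂μ
      ≤ ENNReal.ofReal (L * (1 + ‖θ - ϑ‖ ^ q))) (θ : E) :
    ∫ x, ‖g θ x‖ ∂μ ≤ ‖θ - ϑ‖ / c + 1 + L * (1 + ‖θ - ϑ‖ ^ q) := by
  set u := θ - ϑ
  set G := ∫ x, g θ x ∂μ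
  have hG : ‖G‖ ≤ ‖u‖ / c := norm_le_div_of_coercive hc (hcoer θ)
  rw [← ENNReal.ofReal_le_ofReal_iff (by positivity), ofReal_integral_eq_lintegral_ofReal
    (hgi θ).norm (Filter.Eventually.of_forall fun x => norm_nonneg _)]
  calc ∫⁻ x, ENNReal.ofReal ‖g θ x‖ ∂μ
      ≤ ∫⁻ x, (ENNReal.ofReal (‖u‖ / c + 1) + ‖g θ x - G‖ₑ ^ q) ∂μ := by
        refine lintegral_mono fun x => ?_
        rw [enorm_pow_eq_ofReal, ← ENNReal.ofReal_add (by positivity) (by positivity)]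
        apply ENNReal.ofReal_le_ofReal
        have h1 : ‖g θ x‖ ≤ ‖g θ x - G‖ + ‖G‖ := by simpa using norm_add_le (g θ x - G) G
        have h2 : ‖g θ x - G‖ ≤ 1 + ‖g θ x - G‖ ^ q := by
          rcases le_total ‖g θ x - G‖ 1 with h | h
          · have : 0 ≤ ‖g θ x - G‖ ^ q := by positivity
            linarith
          · linarith [le_self_pow₀ h hq]
        linarith
    _ = ENNReal.ofReal (‖u‖ / c + 1) + ∫⁻ x, ‖g θ x - G‖ₑ ^ q ∂μ := by
        rw [lintegral_add_left measurable_const]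
        simp
    _ ≤ ENNReal.ofReal (‖u‖ / c + 1) + ENNReal.ofReal (L * (1 + ‖u‖ ^ q)) := by
        gcongr; exact hmom θ
    _ = _ := by rw [← ENNReal.ofReal_add (by positivity) (by positivity)]

end Moments

/-! ### Quadratic growth of the objective and the unique minimizer. -/

section Minimizer

variable {E : Type*} [NormedAddCommGroup E] [InnerProductSpace ℝ E] [FiniteDimensional ℝ E]
  [MeasurableSpace E] [BorelSpace E] [SecondCountableTopology E]
  {S : Type*} [MeasurableSpace S] {μ : Measure S} [IsProbabilityMeasure μ] {F : E → S → ℝ}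
  {c L : ℝ} {ϑ : E}

lemma half_mul_norm_sub_sq_le_integral_sub {q : ℕ} (hq : q ≠ 0) (hc : 0 < c) (hL : 0 ≤ L)
    (hF : Measurable (Function.uncurry F)) (hF1 : ∀ x, ContDiff ℝ 1 fun θ => F θ x)
    (hFi : ∀ θ, Integrable (F θ) μ)
    (hgi : ∀ θ, Integrable (fun x => gradient (fun η => F η x) θ) μ)
    (hcoer : ∀ θ, c * max (‖θ - ϑ‖ ^ 2) (‖∫ x, gradient (fun η => F η x) θ ∂μ‖ ^ 2)
      ≤ inner ℝ (θ - ϑ) (∫ x, gradient (fun η => F η x) θ ∂μ))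
    (hmom : ∀ θ, ∫⁻ x, ‖gradient (fun η => F η x) θ
        - ∫ y, gradient (fun η => F η y) θ ∂μ‖ₑ ^ q ∂μ
      ≤ ENNReal.ofReal (L * (1 + ‖θ - ϑ‖ ^ q))) (θ : E) :
    c / 2 * ‖θ - ϑ‖ ^ 2 ≤ ∫ x, F θ x ∂μ - ∫ x, F ϑ x ∂μ := by
  set v := θ - ϑ with hv
  set ψ : ℝ → S → ℝ := fun t x => inner ℝ v (gradient (fun η => F η x) (ϑ + t • v)) with hψ
  have hdiff : ∀ x, Differentiable ℝ fun η => F η x := fun x =>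
    (hF1 x).differentiable one_ne_zero
  have hψm : Measurable (Function.uncurry ψ) := by
    have h1 : Measurable fun z : ℝ × S => (ϑ + z.1 • v, z.2) :=
      ((measurable_fst.smul_const v).const_add ϑ).prodMk measurable_snd
    exact ((measurable_gradient_of_measurable_uncurry hF hdiff).comp h1).const_inner
  have hFTC : ∀ x, F θ x - F ϑ x = ∫ t in Set.Ioc (0 : ℝ) 1, ψ t x := fun x => by
    rw [← intervalIntegral.integral_of_le zero_le_one,
      intervalIntegral.integral_eq_sub_of_hasDerivAt
        (f := fun t : ℝ => F (ϑ + t • v) x)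
        (fun t _ => hasDerivAt_comp_add_smul (hdiff x) ϑ v t)]
    · simp [hv]
    · refine Continuous.intervalIntegrable ?_ _ _
      exact continuous_const.inner ((continuous_gradient (hF1 x)).comp (by fun_prop))
  have hψi : ∀ t, Integrable (ψ t) μ := fun t => (hgi (ϑ + t • v)).const_inner v
  have hint : Integrable (Function.uncurry ψ) ((volume.restrict (Set.Ioc (0 : ℝ) 1)).prod μ) := by
    rw [integrable_prod_iff hψm.aestronglyMeasurable]
    refine ⟨Filter.Eventually.of_forall hψi, ?_⟩
    refine Integrable.of_bound (C := ‖v‖ * (‖v‖ / c + 1 + L * (1 + ‖v‖ ^ q)))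
      hψm.stronglyMeasurable.norm.integral_prod_right.aestronglyMeasurable ?_
    refine (ae_restrict_iff' measurableSet_Ioc).2 (Filter.Eventually.of_forall fun t ht => ?_)
    rw [Real.norm_of_nonneg (integral_nonneg fun x => norm_nonneg _)]
    have h1 := integral_norm_le_of_moment (g := fun θ x => gradient (fun η => F η x) θ)
      hq hc hL hgi hcoer hmom (ϑ + t • v)
    have h2 : ‖ϑ + t • v - ϑ‖ ≤ ‖v‖ := by
      rw [add_sub_cancel_left, norm_smul, Real.norm_of_nonneg ht.1.le]
      exact mul_le_of_le_one_left (norm_nonneg v) ht.2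
    calc ∫ x, ‖ψ t x‖ ∂μ
        ≤ ∫ x, ‖v‖ * ‖gradient (fun η => F η x) (ϑ + t • v)‖ ∂μ :=
          integral_mono (hψi t).norm ((hgi _).norm.const_mul _) fun x => norm_inner_le_norm _ _
      _ = ‖v‖ * ∫ x, ‖gradient (fun η => F η x) (ϑ + t • v)‖ ∂μ := integral_const_mul _ _
      _ ≤ ‖v‖ * (‖ϑ + t • v - ϑ‖ / c + 1 + L * (1 + ‖ϑ + t • v - ϑ‖ ^ q)) := by gcongr
      _ ≤ _ := by gcongr
  -- Coercivity at ϑ + t v carries a factor t on both sides; dividing it out needs t > 0, which the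
  -- half-open interval provides.
  have hlow : ∀ t ∈ Set.Ioc (0 : ℝ) 1, c * ‖v‖ ^ 2 * t ≤ ∫ x, ψ t x ∂μ := fun t ht => by
    have h1 := (mul_le_mul_of_nonneg_left (le_max_left _ _) hc.le).trans (hcoer (ϑ + t • v))
    rw [add_sub_cancel_left, real_inner_smul_left, norm_smul, Real.norm_of_nonneg ht.1.le,
      ← integral_inner (hgi _)] at h1
    refine le_of_mul_le_mul_left ?_ ht.1
    calc t * (c * ‖v‖ ^ 2 * t) = c * (t * ‖v‖) ^ 2 := by ring
      _ ≤ _ := h1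
  calc c / 2 * ‖v‖ ^ 2 = ∫ t in Set.Ioc (0 : ℝ) 1, c * ‖v‖ ^ 2 * t := by
        rw [← intervalIntegral.integral_of_le zero_le_one, intervalIntegral.integral_const_mul,
          integral_id]
        ring
    _ ≤ ∫ t in Set.Ioc (0 : ℝ) 1, ∫ x, ψ t x ∂μ := by
        refine setIntegral_mono_on ?_ hint.integral_prod_left measurableSet_Ioc hlow
        exact ((continuous_const.mul continuous_id).integrableOn_Icc).mono_set
          Set.Ioc_subset_Icc_self
    _ = ∫ x, (∫ t in Set.Ioc (0 : ℝ) 1, ψ t x) ∂μ := integral_integral_swap hint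
    _ = ∫ x, (F θ x - F ϑ x) ∂μ := by simp_rw [hFTC]
    _ = _ := integral_sub (hFi θ) (hFi ϑ)

lemma bddBelow_and_setOf_eq_iInf_of_quadratic_growth {X : Type*} [NormedAddCommGroup X]
    {f : X → ℝ} {a : ℝ} (ha : 0 < a) {x₀ : X} (h : ∀ x, a * ‖x - x₀‖ ^ 2 ≤ f x - f x₀) :
    BddBelow (Set.range f) ∧ {x | f x = ⨅ y, f y} = {x₀} := by
  have hle : ∀ x, f x₀ ≤ f x := fun x => by
    have : 0 ≤ a * ‖x - x₀‖ ^ 2 := by positivity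
    linarith [h x]
  have hb : BddBelow (Set.range f) := ⟨f x₀, by rintro _ ⟨x, rfl⟩; exact hle x⟩
  have hinf : ⨅ y, f y = f x₀ := le_antisymm (ciInf_le hb x₀) (le_ciInf hle)
  refine ⟨hb, Set.ext fun x => ?_⟩
  rw [Set.mem_ofPred_eq, hinf, Set.mem_singleton_iff]
  refine ⟨fun hx => ?_, fun hx => hx ▸ rfl⟩
  have h1 := h x
  rw [hx, sub_self] at h1
  have h2 : ‖x - x₀‖ ^ 2 ≤ 0 := nonpos_of_mul_nonpos_right h1 ha
  have h3 : ‖x - x₀‖ = 0 := by nlinarith [norm_nonneg (x - x₀)]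
  exact sub_eq_zero.1 (norm_eq_zero.1 h3)

end Minimizer

/-! ### The scalar recursion with step sizes of order n^(-ν). -/

section Recursion

lemma eventually_mul_rpow_le {ν : ℝ} (hν1 : ν < 1) {b : ℝ} (hb : 0 < b) (r : ℝ) :
    ∀ᶠ n : ℕ in Filter.atTop, r * ((n + 1 : ℕ) : ℝ) ^ ν ≤ b * ((n + 1 : ℕ) : ℝ) := by
  have h1 : Filter.Tendsto (fun n : ℕ => ((n + 1 : ℕ) : ℝ) ^ (1 - ν)) Filter.atTop Filter.atTop :=
    (tendsto_rpow_atTop (sub_pos.2 hν1)).comp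
      (tendsto_natCast_atTop_atTop.comp (Filter.tendsto_add_atTop_nat 1))
  filter_upwards [h1.eventually_ge_atTop (r / b)] with n hn
  have hpos : (0 : ℝ) < ((n + 1 : ℕ) : ℝ) := by positivity
  rw [div_le_iff₀ hb] at hn
  calc r * ((n + 1 : ℕ) : ℝ) ^ ν
      ≤ ((n + 1 : ℕ) : ℝ) ^ (1 - ν) * b * ((n + 1 : ℕ) : ℝ) ^ ν := by gcongr
    _ = b * (((n + 1 : ℕ) : ℝ) ^ (1 - ν) * ((n + 1 : ℕ) : ℝ) ^ ν) := by ring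
    _ = b * ((n + 1 : ℕ) : ℝ) := by
      rw [← Real.rpow_add hpos, sub_add_cancel, Real.rpow_one]

/-- With a = n + 1, consecutive step sizes have ratio at least a/(a+1) = 1 - 1/(a+1), so by
Bernoulli their r-th powers have ratio at least 1 - r/(a+1). Because ν < 1, the loss r/(a+1) is
eventually below kγ. -/
lemma eventually_one_sub_mul_stepsize_pow_le {α ν k : ℝ} (hα : 0 < α) (hν1 : ν < 1)
    (hk : 0 < k) (r : ℕ) :
    ∀ᶠ n : ℕ in Filter.atTop,
      (1 - k * (α / ((n + 1 : ℕ) : ℝ) ^ ν)) * (α / ((n + 1 : ℕ) : ℝ) ^ ν) ^ r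
        ≤ (α / ((n + 1 + 1 : ℕ) : ℝ) ^ ν) ^ r := by
  filter_upwards [eventually_mul_rpow_le hν1 (mul_pos hk hα) r] with n hn
  set a : ℝ := ((n + 1 : ℕ) : ℝ) with ha
  have ha0 : 0 < a := by positivity
  have ha1 : ((n + 1 + 1 : ℕ) : ℝ) = a + 1 := by rw [ha]; push_cast; ring
  rw [ha1]
  have hav : 0 < a ^ ν := Real.rpow_pos_of_pos ha0 ν
  have hav1 : 0 < (a + 1) ^ ν := Real.rpow_pos_of_pos (by linarith) ν
  set γ := α / a ^ ν with hγ
  have hγ0 : 0 < γ := by positivity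
  have h1 : (r : ℝ) / (a + 1) ≤ k * γ := by
    rw [hγ, mul_div_assoc', div_le_div_iff₀ (by linarith) hav]
    nlinarith [mul_pos hk hα]
  have h2 : (a + 1) ^ ν ≤ a ^ ν * ((a + 1) / a) := by
    have h3 : ((a + 1) / a) ^ ν ≤ (a + 1) / a :=
      Real.rpow_le_self_of_one_le (by rw [le_div_iff₀ ha0]; linarith) hν1.le
    rw [Real.div_rpow (by linarith) ha0.le, div_le_iff₀ hav] at h3
    linarith
  have h4 : (1 + -(1 / (a + 1))) * γ ≤ α / (a + 1) ^ ν := by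
    have h5 : 1 + -(1 / (a + 1)) = a / (a + 1) := by field_simp; ring
    rw [h5, hγ, le_div_iff₀ hav1]
    calc a / (a + 1) * (α / a ^ ν) * (a + 1) ^ ν
        ≤ a / (a + 1) * (α / a ^ ν) * (a ^ ν * ((a + 1) / a)) := by gcongr
      _ = α := by field_simp
  have h6 : 1 / (a + 1) ≤ 1 := by rw [div_le_one (by linarith)]; linarith
  have h7 := one_add_mul_le_pow (a := -(1 / (a + 1))) (by linarith) r
  calc (1 - k * γ) * γ ^ r ≤ (1 + r * -(1 / (a + 1))) * γ ^ r := by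
        gcongr
        rw [mul_neg, mul_one_div]
        linarith
    _ ≤ (1 + -(1 / (a + 1))) ^ r * γ ^ r := by gcongr
    _ = ((1 + -(1 / (a + 1))) * γ) ^ r := by rw [mul_pow]
    _ ≤ _ := by
        gcongr
        exact mul_nonneg (by linarith) hγ0.le

/-- Induction with half of the contraction k paying for the forcing term and the other half for the
decrease of the step size. -/
lemma exists_le_mul_stepsize_pow {α ν k K : ℝ} (hα : 0 < α) (hν1 : ν < 1)
    (hk : 0 < k) (hK : 0 ≤ K) (r : ℕ) {a : ℕ → ℝ} (ha : ∀ n, 0 ≤ a n)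
    (hcontr : ∀ᶠ n : ℕ in Filter.atTop, k * (α / ((n + 1 : ℕ) : ℝ) ^ ν) ≤ 1)
    (hrec : ∀ᶠ n : ℕ in Filter.atTop,
      a (n + 1) ≤ (1 - k * (α / ((n + 1 : ℕ) : ℝ) ^ ν)) * a n
        + K * (α / ((n + 1 : ℕ) : ℝ) ^ ν) ^ (r + 1)) :
    ∃ B : ℝ, 0 < B ∧ ∀ n : ℕ, a n ≤ B * (α / ((n + 1 : ℕ) : ℝ) ^ ν) ^ r := by
  obtain ⟨N, hN⟩ := Filter.eventually_atTop.1
    (hcontr.and (hrec.and (eventually_one_sub_mul_stepsize_pow_le hα hν1 (half_pos hk) r)))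
  set γ : ℕ → ℝ := fun n => α / ((n + 1 : ℕ) : ℝ) ^ ν with hγ
  have hγ0 : ∀ n, 0 < γ n := fun n => div_pos hα (Real.rpow_pos_of_pos (by positivity) ν)
  have hterm : ∀ i, 0 ≤ a i / γ i ^ r := fun i => div_nonneg (ha i) (pow_pos (hγ0 i) r).le
  -- The 1 gives positivity, 2K/k gives K ≤ (k/2) B, and the sum covers the indices up to N, before
  -- the eventual estimates apply.
  set B := 1 + 2 * K / k + ∑ i ∈ Finset.range (N + 1), a i / γ i ^ r with hB
  have hsum : 0 ≤ ∑ i ∈ Finset.range (N + 1), a i / γ i ^ r :=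
    Finset.sum_nonneg fun i _ => hterm i
  have hKk : 0 ≤ 2 * K / k := by positivity
  have hB0 : 0 < B := by linarith
  have hKB : K ≤ k / 2 * B := by
    have h1 : k / 2 * (2 * K / k) = K := by field_simp
    have h2 : 2 * K / k ≤ B := by linarith
    calc K = k / 2 * (2 * K / k) := h1.symm
      _ ≤ _ := by gcongr
  have hsmall : ∀ n ≤ N, a n ≤ B * γ n ^ r := fun n hn => by
    rw [← div_le_iff₀ (pow_pos (hγ0 n) r)]
    have := Finset.single_le_sum (f := fun i => a i / γ i ^ r) (fun i _ => hterm i)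
      (Finset.mem_range.2 (Nat.lt_succ_of_le hn))
    linarith
  have hlarge : ∀ n, N ≤ n → a n ≤ B * γ n ^ r := fun n hn => by
    induction n, hn using Nat.le_induction with
    | base => exact hsmall N le_rfl
    | succ n hn ih =>
      obtain ⟨h1, h2, h3⟩ := hN n hn
      have hγn := hγ0 n
      change k * γ n ≤ 1 at h1
      change a (n + 1) ≤ (1 - k * γ n) * a n + K * γ n ^ (r + 1) at h2
      change (1 - k / 2 * γ n) * γ n ^ r ≤ γ (n + 1) ^ r at h3
      have h4 : 0 ≤ 1 - k * γ n := by linarith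
      calc a (n + 1) ≤ (1 - k * γ n) * a n + K * γ n ^ (r + 1) := h2
        _ ≤ (1 - k * γ n) * (B * γ n ^ r) + k / 2 * B * γ n ^ (r + 1) := by gcongr
        _ = B * ((1 - k / 2 * γ n) * γ n ^ r) := by ring
        _ ≤ _ := by gcongr
  exact ⟨B, hB0, fun n => (le_total n N).elim (hsmall n) (hlarge n)⟩

lemma tendsto_stepsize {α ν : ℝ} (hν0 : 0 < ν) :
    Filter.Tendsto (fun n : ℕ => α / ((n + 1 : ℕ) : ℝ) ^ ν) Filter.atTop (nhds 0) :=
  ((tendsto_rpow_atTop hν0).comp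
    (tendsto_natCast_atTop_atTop.comp (Filter.tendsto_add_atTop_nat 1))).const_div_atTop α

end Recursion

/-! ### Independence of the current iterate and the next sample. -/

section RecursiveSequence

variable {Ω E S : Type*} [MeasurableSpace E] [MeasurableSpace S]

/-- The n-th iterate sees only samples 0, …, n - 1; this factorization yields both its measurability
and its independence of sample n. -/
lemma exists_measurable_of_recursion {Y : ℕ → Ω → S} {Z : ℕ → Ω → E} {ξ : E}
    {T : ℕ → E × S → E} (hT : ∀ n, Measurable (T n)) (h0 : ∀ ω, Z 0 ω = ξ)
    (h : ∀ n ω, Z (n + 1) ω = T n (Z n ω, Y n ω)) (n : ℕ) :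
    ∃ φ : (Finset.range n → S) → E, Measurable φ ∧ Z n = fun ω => φ fun i => Y i ω := by
  induction n with
  | zero => exact ⟨fun _ => ξ, measurable_const, funext h0⟩
  | succ n ih =>
    obtain ⟨φ, hφ, hZ⟩ := ih
    have hsub : ∀ i : Finset.range n, (i : ℕ) ∈ Finset.range (n + 1) := fun i =>
      Finset.mem_range.2 ((Finset.mem_range.1 i.2).trans n.lt_succ_self)
    refine ⟨fun y => T n (φ fun i => y ⟨i, hsub i⟩, y ⟨n, Finset.self_mem_range_succ n⟩),
      (hT n).comp ((hφ.comp (measurable_pi_lambda _ fun i => measurable_pi_apply _)).prodMk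
        (measurable_pi_apply _)), ?_⟩
    funext ω
    rw [h, hZ]

variable [MeasurableSpace Ω] {P : Measure Ω}

lemma indepFun_of_recursion {Y : ℕ → Ω → S} (hYm : ∀ n, Measurable (Y n)) (hY : iIndepFun Y P)
    {Z : ℕ → Ω → E} {ξ : E} {T : ℕ → E × S → E} (hT : ∀ n, Measurable (T n))
    (h0 : ∀ ω, Z 0 ω = ξ) (h : ∀ n ω, Z (n + 1) ω = T n (Z n ω, Y n ω)) (n : ℕ) :
    IndepFun (Z n) (Y n) P := by
  obtain ⟨φ, hφ, hZ⟩ := exists_measurable_of_recursion hT h0 h n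
  have h1 := hY.indepFun_finset (Finset.range n) {n} (by simp) hYm
  rw [hZ]
  exact h1.comp hφ (measurable_pi_apply (⟨n, Finset.mem_singleton_self n⟩ : ({n} : Finset ℕ)))

lemma measurable_of_recursion {Y : ℕ → Ω → S} (hYm : ∀ n, Measurable (Y n))
    {Z : ℕ → Ω → E} {ξ : E} {T : ℕ → E × S → E} (hT : ∀ n, Measurable (T n))
    (h0 : ∀ ω, Z 0 ω = ξ) (h : ∀ n ω, Z (n + 1) ω = T n (Z n ω, Y n ω)) (n : ℕ) :
    Measurable (Z n) := by
  obtain ⟨φ, hφ, hZ⟩ := exists_measurable_of_recursion hT h0 h n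
  rw [hZ]
  exact hφ.comp (measurable_pi_lambda _ fun i => hYm i)

/-- Independence makes the joint law a product, so Tonelli freezes the iterate and averages over the
fresh sample; this replaces conditional expectation. -/
lemma lintegral_comp_prod_of_indepFun [IsProbabilityMeasure P] {Z : Ω → E} {Y : Ω → S}
    (hZ : Measurable Z) (hY : Measurable Y) (hind : IndepFun Z Y P)
    {f : E × S → ENNReal} (hf : Measurable f) :
    ∫⁻ ω, f (Z ω, Y ω) ∂P = ∫⁻ ω, ∫⁻ x, f (Z ω, x) ∂(P.map Y) ∂P := by
  have := Measure.isProbabilityMeasure_map (μ := P) hY.aemeasurable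
  rw [← lintegral_map hf (hZ.prodMk hY), (indepFun_iff_map_prod_eq_prod_map_map
    hZ.aemeasurable hY.aemeasurable).1 hind, lintegral_prod _ hf.aemeasurable,
    lintegral_map hf.lintegral_prod_right' hZ]

end RecursiveSequence

/-! ### From a bound at fixed θ to a bound at the random iterate. -/

section Step

variable {Ω E S : Type*} [MeasurableSpace Ω] {P : Measure Ω} [IsProbabilityMeasure P]
  [NormedAddCommGroup E] [NormedSpace ℝ E] [MeasurableSpace E] [BorelSpace E]
  [SecondCountableTopology E] [MeasurableSpace S]

lemma lintegral_step_le {Z : Ω → E} {Y : Ω → S} (hZ : Measurable Z) (hY : Measurable Y)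
    (hind : IndepFun Z Y P) {g : E → S → E} (hg : Measurable (Function.uncurry g)) {ϑ : E}
    {η A B : ℝ} {q : ℕ} (hA : 0 ≤ A) (hB : 0 ≤ B)
    (h : ∀ θ, ∫⁻ x, ‖θ - ϑ - η • g θ x‖ₑ ^ q ∂(P.map Y)
      ≤ ENNReal.ofReal (A * ‖θ - ϑ‖ ^ q + B)) :
    ∫⁻ ω, ‖Z ω - η • g (Z ω) (Y ω) - ϑ‖ₑ ^ q ∂P
      ≤ ENNReal.ofReal A * ∫⁻ ω, ‖Z ω - ϑ‖ₑ ^ q ∂P + ENNReal.ofReal B := by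
  have hf : Measurable fun z : E × S => ‖z.1 - ϑ - η • g z.1 z.2‖ₑ ^ q :=
    (((measurable_fst.sub_const ϑ).sub (hg.const_smul η)).enorm).pow_const q
  calc ∫⁻ ω, ‖Z ω - η • g (Z ω) (Y ω) - ϑ‖ₑ ^ q ∂P
      = ∫⁻ ω, ‖Z ω - ϑ - η • g (Z ω) (Y ω)‖ₑ ^ q ∂P := by simp_rw [sub_right_comm]
    _ = ∫⁻ ω, ∫⁻ x, ‖Z ω - ϑ - η • g (Z ω) x‖ₑ ^ q ∂(P.map Y) ∂P :=
        lintegral_comp_prod_of_indepFun hZ hY hind hf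
    _ ≤ ∫⁻ ω, (ENNReal.ofReal A * ‖Z ω - ϑ‖ₑ ^ q + ENNReal.ofReal B) ∂P := by
        refine lintegral_mono fun ω => (h (Z ω)).trans_eq ?_
        rw [enorm_pow_eq_ofReal, ← ENNReal.ofReal_mul hA,
          ENNReal.ofReal_add (by positivity) hB]
    _ = _ := by
        rw [lintegral_add_right _ measurable_const, lintegral_const_mul' _ _ ENNReal.ofReal_ne_top]
        simp

end Step

/-! ### Decay of the moments of the error. -/

section Rate

variable {Ω E S : Type*} [MeasurableSpace Ω] {P : Measure Ω} [IsProbabilityMeasure P]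
  [NormedAddCommGroup E] [MeasurableSpace E] [BorelSpace E] [SecondCountableTopology E]
  [MeasurableSpace S]

lemma exists_lintegral_norm_pow_le_mul_stepsize [InnerProductSpace ℝ E] [CompleteSpace E]
    {α ν c L : ℝ} (hα : 0 < α) (hν0 : 0 < ν) (hν1 : ν < 1) (hc : 0 < c) (hL : 0 ≤ L) (m : ℕ) {Y : ℕ → Ω → S}
    (hYm : ∀ n, Measurable (Y n)) (hY : iIndepFun Y P) {μ : Measure S} [IsProbabilityMeasure μ]
    (hYμ : ∀ n, P.map (Y n) = μ) {g : E → S → E} (hg : Measurable (Function.uncurry g)) {ϑ ξ : E}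
    (hgi : ∀ θ, Integrable (g θ) μ)
    (hcoer : ∀ θ, c * max (‖θ - ϑ‖ ^ 2) (‖∫ x, g θ x ∂μ‖ ^ 2)
      ≤ inner ℝ (θ - ϑ) (∫ x, g θ x ∂μ))
    (hmom : ∀ θ, ∫⁻ x, ‖g θ x - ∫ y, g θ y ∂μ‖ₑ ^ (2 * (m + 1)) ∂μ
      ≤ ENNReal.ofReal (L * (1 + ‖θ - ϑ‖ ^ (2 * (m + 1)))))
    {Z : ℕ → Ω → E} (h0 : ∀ ω, Z 0 ω = ξ)
    (hZ : ∀ (n : ℕ) ω,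
      Z (n + 1) ω = Z n ω - (α / ((n + 1 : ℕ) : ℝ) ^ ν) • g (Z n ω) (Y n ω)) :
    (∀ n, Measurable (Z n)) ∧ ∃ B : ℝ, 0 < B ∧ ∀ n : ℕ,
      ∫⁻ ω, ‖Z n ω - ϑ‖ₑ ^ (2 * (m + 1)) ∂P
        ≤ ENNReal.ofReal (B * (α / ((n + 1 : ℕ) : ℝ) ^ ν) ^ (m + 1)) := by
  set γ : ℕ → ℝ := fun n => α / ((n + 1 : ℕ) : ℝ) ^ ν with hγ
  have hγ0 : ∀ n, 0 < γ n := fun n => div_pos hα (Real.rpow_pos_of_pos (by positivity) ν)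
  set T : ℕ → E × S → E := fun n z => z.1 - γ n • g z.1 z.2 with hT
  have hTm : ∀ n, Measurable (T n) := fun n => measurable_fst.sub (hg.const_smul (γ n))
  have hZm := measurable_of_recursion hYm hTm h0 hZ
  have hind := indepFun_of_recursion hYm hY hTm h0 hZ
  refine ⟨hZm, ?_⟩
  set a : ℕ → ENNReal := fun n => ∫⁻ ω, ‖Z n ω - ϑ‖ₑ ^ (2 * (m + 1)) ∂P with ha
  have hstep : ∀ n (A B : ℝ), 0 ≤ A → 0 ≤ B →
      (∀ θ, ∫⁻ x, ‖θ - ϑ - γ n • g θ x‖ₑ ^ (2 * (m + 1)) ∂μ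
        ≤ ENNReal.ofReal (A * ‖θ - ϑ‖ ^ (2 * (m + 1)) + B)) →
      a (n + 1) ≤ ENNReal.ofReal A * a n + ENNReal.ofReal B := fun n A B hA hB h => by
    have := lintegral_step_le (hZm n) (hYm n) (hind n) hg hA hB (by rw [hYμ n]; exact h)
    simpa only [ha, hZ n] using this
  -- Finiteness must come first: the scalar recursion is run on `toReal`, which would send an
  -- infinite moment to 0.
  have hfin : ∀ n, a n ≠ ⊤ := fun n => by
    induction n with
    | zero => simp [ha, h0]
    | succ n ih =>
      obtain ⟨A, hA, h⟩ := exists_step_growth (2 * (m + 1)) hc hL hcoer hmom (hγ0 n).le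
      exact ne_top_of_le_ne_top (ENNReal.add_ne_top.2
        ⟨ENNReal.mul_ne_top ENNReal.ofReal_ne_top ih, ENNReal.ofReal_ne_top⟩)
        (hstep n A A hA hA h)
  obtain ⟨η₀, K, hη₀, hcη₀, hK, hcontr⟩ := exists_step_contraction m hc hL hgi hcoer hmom
  have hev : ∀ᶠ n in Filter.atTop, γ n ≤ η₀ := (tendsto_stepsize hν0).eventually_le_const hη₀
  have hle1 : ∀ n, γ n ≤ η₀ → c / 4 * γ n ≤ 1 := fun n hn => by
    have : c * γ n ≤ c * η₀ := by gcongr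
    have := mul_pos hc (hγ0 n)
    linarith
  obtain ⟨B, hB, hBle⟩ := exists_le_mul_stepsize_pow (a := fun n => (a n).toReal) (K := K)
    hα hν1 (by positivity : 0 < c / 4) hK (m + 1) (fun n => ENNReal.toReal_nonneg)
    (hev.mono hle1) (hev.mono fun n hn => by
      have hA : 0 ≤ 1 - c / 4 * γ n := by linarith [hle1 n hn]
      have hB : 0 ≤ K * γ n ^ (m + 2) := mul_nonneg hK (pow_pos (hγ0 n) _).le
      have h1 := hstep n _ _ hA hB (hcontr (γ n) (hγ0 n).le hn)
      rw [← ENNReal.ofReal_toReal (hfin n), ← ENNReal.ofReal_mul hA, ← ENNReal.ofReal_add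
        (mul_nonneg hA ENNReal.toReal_nonneg) hB] at h1
      exact ENNReal.toReal_le_of_le_ofReal
        (add_nonneg (mul_nonneg hA ENNReal.toReal_nonneg) hB) h1)
  refine ⟨B, hB, fun n => ?_⟩
  exact (ENNReal.le_ofReal_iff_toReal_le (hfin n)
    (mul_nonneg hB.le (pow_pos (hγ0 n) _).le)).2 (hBle n)

/-- L^p norms increase with the exponent under a probability measure, and (m+1)/(2(m+1)) = 1/2
explains the square root. -/
lemma lintegral_rpow_rpow_inv_le_of_lintegral_pow_le {f : Ω → E} (hf : Measurable f) {p B t : ℝ}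
    (hp : 0 < p) {m : ℕ} (hpm : p ≤ ((2 * (m + 1) : ℕ) : ℝ)) (hB : 0 ≤ B) (ht : 0 ≤ t)
    (h : ∫⁻ ω, ‖f ω‖ₑ ^ (2 * (m + 1)) ∂P ≤ ENNReal.ofReal (B * t ^ (m + 1))) :
    (∫⁻ ω, ‖f ω‖ₑ ^ p ∂P) ^ (1 / p)
      ≤ ENNReal.ofReal (B ^ (1 / ((2 * (m + 1) : ℕ) : ℝ)) * t ^ (1 / 2 : ℝ)) := by
  have h1 := eLpNorm'_le_eLpNorm'_of_exponent_le hp hpm P hf.aestronglyMeasurable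
  simp only [eLpNorm', ENNReal.rpow_natCast] at h1
  refine h1.trans ((ENNReal.rpow_le_rpow h (by positivity)).trans_eq ?_)
  rw [ENNReal.ofReal_rpow_of_nonneg (by positivity) (by positivity),
    Real.mul_rpow hB (by positivity), ← Real.rpow_natCast t, ← Real.rpow_mul ht]
  congr 3
  push_cast
  field_simp

end Rate

/-! ### The main theorem. -/

theorem theorem1p1
    {d : ℕ} (hd : 1 ≤ d)
    {p α κ c ν : ℝ} (hp : 0 < p) (hα : 0 < α) (hκ : 0 < κ) (hc : 0 < c)
    (hν0 : 0 < ν) (hν1 : ν < 1)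
    {q : ℕ} (hq : IsLeast {k : ℕ | 0 < k ∧ Even k ∧ p ≤ (k : ℝ)} q)
    (ξ ϑ : EuclideanSpace ℝ (Fin d))
    {Ω : Type*} [MeasurableSpace Ω] (P : Measure Ω) [IsProbabilityMeasure P]
    {S : Type*} [MeasurableSpace S]
    -- the i.i.d. data `X 1, X 2, X 3, …`
    (X : ℕ+ → Ω → S) (hXmeas : ∀ n, Measurable (X n))
    (hXindep : iIndepFun X P) (hXident : ∀ n, IdentDistrib (X n) (X 1) P P)
    (F : EuclideanSpace ℝ (Fin d) → S → ℝ)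
    (hFmeas : Measurable (Function.uncurry F))
    (hFC1 : ∀ x, ContDiff ℝ 1 (fun θ => F θ x))
    (hFint : ∀ θ, Integrable (fun ω => F θ (X 1 ω)) P)
    (hGint : ∀ θ, Integrable (fun ω => gradient (fun η => F η (X 1 ω)) θ) P)
    (hcoer : ∀ θ, c * max (‖θ - ϑ‖ ^ 2)
          (‖∫ ω, gradient (fun η => F η (X 1 ω)) θ ∂P‖ ^ 2)
        ≤ inner ℝ (θ - ϑ) (∫ ω, gradient (fun η => F η (X 1 ω)) θ ∂P))
    (hmom : ∀ θ,
      ∫⁻ ω, ‖gradient (fun η => F η (X 1 ω)) θ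
            - ∫ ω', gradient (fun η => F η (X 1 ω')) θ ∂P‖ₑ ^ q ∂P
        ≤ ENNReal.ofReal (κ * (1 + ‖θ‖ ^ q)))
    (Θ : ℕ → Ω → EuclideanSpace ℝ (Fin d))
    (hΘ0 : ∀ ω, Θ 0 ω = ξ)
    (hΘ : ∀ (n : ℕ) (ω : Ω), Θ (n + 1) ω = Θ n ω
        - (α / ((n + 1 : ℕ) : ℝ) ^ ν) •
          gradient (fun η => F η (X n.succPNat ω)) (Θ n ω)) :
    (BddBelow (Set.range fun v => ∫ ω, F v (X 1 ω) ∂P) ∧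
      {θ | ∫ ω, F θ (X 1 ω) ∂P = ⨅ v, ∫ ω, F v (X 1 ω) ∂P} = {ϑ}) ∧
    ∃ C : ℝ, 0 < C ∧ ∀ n : ℕ, 1 ≤ n →
      (∫⁻ ω, ‖Θ n ω - ϑ‖ₑ ^ p ∂P) ^ (1 / p)
        ≤ ENNReal.ofReal (C * (n : ℝ) ^ (-(ν / 2))) := by
  obtain ⟨⟨hq0, hqe, hpq⟩, -⟩ := hq
  obtain ⟨m, rfl⟩ : ∃ m, q = 2 * (m + 1) := by
    obtain ⟨k, rfl⟩ := hqe
    exact ⟨k - 1, by omega⟩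
  set g : EuclideanSpace ℝ (Fin d) → S → EuclideanSpace ℝ (Fin d) :=
    fun θ x => gradient (fun η => F η x) θ with hg
  have hgm : Measurable (Function.uncurry g) :=
    measurable_gradient_of_measurable_uncurry hFmeas fun x =>
      (hFC1 x).differentiable one_ne_zero
  have hgθ : ∀ θ, Measurable (g θ) := fun θ => hgm.comp measurable_prodMk_left
  have hFθ : ∀ θ, Measurable (F θ) := fun θ => hFmeas.comp measurable_prodMk_left
  set μ := P.map (X 1) with hμ
  have hX1 : AEMeasurable (X 1) P := (hXmeas 1).aemeasurable
  have : IsProbabilityMeasure μ := Measure.isProbabilityMeasure_map hX1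
  have hgint : ∀ θ, ∫ ω, gradient (fun η => F η (X 1 ω)) θ ∂P = ∫ x, g θ x ∂μ := fun θ =>
    (integral_map hX1 (hgθ θ).aestronglyMeasurable).symm
  have hFint' : ∀ θ, ∫ ω, F θ (X 1 ω) ∂P = ∫ x, F θ x ∂μ := fun θ =>
    (integral_map hX1 (hFθ θ).aestronglyMeasurable).symm
  have hFi : ∀ θ, Integrable (F θ) μ := fun θ =>
    (integrable_map_measure (hFθ θ).aestronglyMeasurable hX1).2 (hFint θ)
  have hgi : ∀ θ, Integrable (g θ) μ := fun θ =>
    (integrable_map_measure (hgθ θ).aestronglyMeasurable hX1).2 (hGint θ)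
  simp_rw [hgint] at hcoer hmom
  -- Recentre the moment bound from the origin to ϑ, so that it is expressed in the error that the
  -- recursion controls.
  obtain ⟨L, hL, hκL⟩ := exists_mul_one_add_norm_pow_le hκ.le (2 * (m + 1)) ϑ
  have hmom' : ∀ θ, ∫⁻ x, ‖g θ x - ∫ y, g θ y ∂μ‖ₑ ^ (2 * (m + 1)) ∂μ
      ≤ ENNReal.ofReal (L * (1 + ‖θ - ϑ‖ ^ (2 * (m + 1)))) := fun θ => by
    rw [hμ, lintegral_map (((hgθ θ).sub_const _).enorm.pow_const _) (hXmeas 1)]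
    exact (hmom θ).trans (ENNReal.ofReal_le_ofReal (hκL θ))
  refine ⟨?_, ?_⟩
  · simp_rw [hFint']
    exact bddBelow_and_setOf_eq_iInf_of_quadratic_growth (half_pos hc)
      (half_mul_norm_sub_sq_le_integral_sub (by omega) hc hL hFmeas hFC1 hFi hgi hcoer hmom')
  -- The samples are shifted to start at index 0, so `Y n` is the sample used to pass from iterate n
  -- to n + 1.
  · obtain ⟨hΘm, B, hB, hBle⟩ := exists_lintegral_norm_pow_le_mul_stepsize hα hν0 hν1 hc hL m
      (Y := fun n => X n.succPNat) (fun n => hXmeas _) (hXindep.precomp Nat.succPNat_injective)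
      (fun n => (hXident _).map_eq) hgm hgi hcoer hmom' hΘ0 hΘ
    refine ⟨B ^ (1 / ((2 * (m + 1) : ℕ) : ℝ)) * α ^ (1 / 2 : ℝ), by positivity, fun n hn => ?_⟩
    have hn0 : (0 : ℝ) < n := by exact_mod_cast hn
    refine (lintegral_rpow_rpow_inv_le_of_lintegral_pow_le ((hΘm n).sub_const ϑ) hp hpq hB.le
      (div_nonneg hα.le (Real.rpow_nonneg (Nat.cast_nonneg _) ν)) (hBle n)).trans ?_
    apply ENNReal.ofReal_le_ofReal
    rw [mul_assoc]
    gcongr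
    -- The moment bound for iterate n involves the step size of index n + 1, which is at most the
    -- one of index n.
    have h1 : α / ((n + 1 : ℕ) : ℝ) ^ ν ≤ α * (n : ℝ) ^ (-ν) := by
      rw [Real.rpow_neg hn0.le, ← div_eq_mul_inv]
      gcongr
      exact n.le_succ
    calc (α / ((n + 1 : ℕ) : ℝ) ^ ν) ^ (1 / 2 : ℝ) ≤ (α * (n : ℝ) ^ (-ν)) ^ (1 / 2 : ℝ) := by
          gcongr
      _ = α ^ (1 / 2 : ℝ) * (n : ℝ) ^ (-(ν / 2)) := by
          rw [Real.mul_rpow hα.le (by positivity), ← Real.rpow_mul hn0.le]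
          congr 2
          ring
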